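/- **Conventions.** Graphs are simple and undirected, without loops. For a finite graph $\Gamma$ with nonempty vertex set, the right-angled Coxeter group $W_\Gamma$ is the group generated by the vertices of $\Gamma$ subject to $v^2=1$ for every vertex $v$ and $vw=wv$ for every edge $\{v,w\}$; a group is a *right-angled Coxeter group* (RACG) if it is isomorphic to some such $W_\Gamma$. A *clique* is a nonempty set of pairwise adjacent vertices; the *clique graph* $\Gamma_K$ has the cliques of $\Gamma$ as its vertices, two distinct cliques being adjacent when their union is a clique. A graph is called a clique graph if it is isomorphic to $\Gamma_K$ for some finite graph $\Gamma$ with nonempty vertex set. For a vertex $v$, $\mathrm{St}(v)$ is the set consisting of $v$ and its neighbours, $[v]=\{u:\mathrm{St}(u)=\mathrm{St}(v)\}$, and $[v]\le[w]$ means $\mathrm{St}(v)\subseteq\mathrm{St}(w)$. An involution is an element of order $2$, and $\overline g$ is the image of $g\in G$ in the abelianization $G^{ab}$. **Theorem.** Let $G$ be a group all of whose nontrivial torsion elements have order $2$ and such that $G^{ab}\cong(\mathbb Z/2\mathbb Z)^n$ for some $n$. Consider the following procedure, which involves choices. 1. Let the vertices of $\Gamma'$ be the conjugacy classes of involutions of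 $G$. If there are infinitely many, return **False**. 2. Join two distinct classes $[x],[y]$ by an edge of $\Gamma'$ if and only if there is another conjugacy class $[z]$ of involutions with $\overline z=\overline{xy}$ in $G^{ab}$. 3. If $\Gamma'$ is not a clique graph, return **False**. 4. Choose a full system of representatives: one representative $\rho(c)\in c$ for each vertex $c$ of $\Gamma'$, such that $\rho(c)$ and $\rho(d)$ commute for every edge $\{c,d\}$ of $\Gamma'$. If no such system exists, return **False**. 5. Collapse: start with $V=\varnothing$. As long as there are star-equivalence classes of vertices of $\Gamma'$ that have not been considered, take such a class $[w]$ for which every class $[v]>[w]$ has already been considered; put $S_w=\bigcup_{[v]\ge[w]}[v]$, write $|S_w|=2^k-1$, let $k'=|S_w\cap V|$, and add $k-k'$ vertices of $[w]$ to $V$, chosen such that the chosen vertices have no nontrivial product relation in $G^{ab}$, i.e. such that $\prod_{c\in F}\overline{\rho(c)}\ne1$ for every nonempty finite set $F$ of vertices chosen so far. If such a choice is impossible, return **Unknown**. When all classes have been considered, let $C(\Gamma')$ be the subgraph of $\Gamma'$ induced on $V$. 6. Let $\Gamma=C(\Gamma')$ and let $\varphi\colon W_\Gamma\to G$ be the homomorphism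 that sends the generator $c\in V$ to its label $\rho(c)$. If $\varphi$ is an isomorphism, return **True**. 7. Otherwise, return **Unknown**. If some run of the procedure returns **True**, then $G$ is a right-angled Coxeter group; more precisely, $G$ has the right-angled Coxeter presentation with defining graph $C(\Gamma')$ and generators the labels $\rho(c)$, $c\in V$, of that run. If some run returns **False**, then $G$ is not a right-angled Coxeter group. -/

import Mathlib

namespace RACG

universe u v

noncomputable section

/-! ### Right-angled Coxeter groups -/

open Classical in
/-- The Coxeter matrix of the right-angled Coxeter group `W_Γ`: entry `2` for adjacent vertices
(they commute), entry `0` (no relation) for distinct non-adjacent vertices. -/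
def coxMatrix {V : Type u} (Γ : SimpleGraph V) : CoxeterMatrix V where
  M := Matrix.of fun i j => if i = j then 1 else if Γ.Adj i j then 2 else 0
  isSymm := by
    ext i j
    simp [Matrix.transpose_apply, eq_comm, Γ.adj_comm]
  diagonal i := by simp
  off_diagonal i j h := by
    simp only [Matrix.of_apply, h, if_false]
    split_ifs <;> simp

/-- The right-angled Coxeter group `W_Γ`. -/
abbrev W {V : Type u} (Γ : SimpleGraph V) : Type u := (coxMatrix Γ).Group

/-- `G` is a right-angled Coxeter group: it is isomorphic to `W_Γ` for some finite simple graph `Γ`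
with nonempty vertex set. -/
def IsRACG (G : Type u) [Group G] : Prop :=
  ∃ (V : Type) (_ : Finite V) (_ : Nonempty V) (Γ : SimpleGraph V), Nonempty (W Γ ≃* G)

/-! ### Clique graphs -/

/-- A clique of `Γ`: a nonempty finite set of pairwise adjacent vertices. -/
def Clique {V : Type u} (Γ : SimpleGraph V) : Type u :=
  {s : Finset V // s.Nonempty ∧ Γ.IsClique (s : Set V)}

/-- The clique graph `Γ_K`: two distinct cliques are adjacent when their union is a clique. -/
def cliqueGraph {V : Type u} (Γ : SimpleGraph V) : SimpleGraph (Clique Γ) where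
  Adj s t := s ≠ t ∧ Γ.IsClique ((s.1 : Set V) ∪ (t.1 : Set V))
  symm := ⟨fun s t h => ⟨h.1.symm, by rw [Set.union_comm]; exact h.2⟩⟩
  loopless := ⟨fun _ h => h.1 rfl⟩

/-- `Γ'` is (isomorphic to) the clique graph of a finite graph with nonempty vertex set. -/
def IsCliqueGraph {V : Type u} (Γ' : SimpleGraph V) : Prop :=
  ∃ (U : Type) (_ : Finite U) (_ : Nonempty U) (Γ : SimpleGraph U),
    Nonempty (Γ' ≃g cliqueGraph Γ)

/-! ### The star poset -/

/-- The star of a vertex: the vertex together with its neighbours. -/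
def star {V : Type u} (Γ : SimpleGraph V) (v : V) : Set V := insert v (Γ.neighborSet v)

/-- The star-equivalence class `[w]`. -/
def starClass {V : Type u} (Γ : SimpleGraph V) (w : V) : Set V := {v | star Γ v = star Γ w}

/-- `S_w`, the union of all classes `[v]` with `[w] ≤ [v]`. -/
def cliqueAbove {V : Type u} (Γ : SimpleGraph V) (w : V) : Set V := {v | star Γ w ⊆ star Γ v}

/-! ### Classes of involutions, and the graph read off from the abelianization -/

section Group

variable (G : Type u) [Group G]

/-- The conjugacy classes of involutions (elements of order two) of `G`. -/
def InvolutionClass : Type u :=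
  {c : ConjClasses G // ∃ x : G, orderOf x = 2 ∧ ConjClasses.mk x = c}

variable {G}

/-- The common image in `Gᵃᵇ` of the elements of a conjugacy class. -/
def classImage (c : ConjClasses G) : Abelianization G :=
  Quotient.liftOn c Abelianization.of fun a b h => by
    obtain ⟨g, hg⟩ := isConj_iff.mp h
    rw [← hg]
    simp

@[simp] theorem classImage_mk (x : G) : classImage (ConjClasses.mk x) = Abelianization.of x := rfl

/-- The image in `Gᵃᵇ` of a class of involutions. -/
def InvolutionClass.image (c : InvolutionClass G) : Abelianization G := classImage c.1

variable (G) in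
/-- The graph `Γ'`: its vertices are the classes of involutions, and two classes `[x]`, `[y]` are
adjacent when there is another class of involutions `[z]` with the same image in `Gᵃᵇ` as `xy`. -/
def edgeGraph : SimpleGraph (InvolutionClass G) where
  Adj x y := x ≠ y ∧ ∃ z : InvolutionClass G, z ≠ x ∧ z ≠ y ∧ z.image = x.image * y.image
  symm := ⟨fun x y ⟨h, z, hx, hy, hz⟩ => ⟨h.symm, z, hy, hx, by rw [hz, mul_comm]⟩⟩
  loopless := ⟨fun _ h => h.1 rfl⟩

/-- A full system of representatives for the vertices of `Γ'`: one representative of each class,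
such that these commute along all the edges simultaneously. -/
def IsFullSystem (ρ : InvolutionClass G → G) : Prop :=
  (∀ c, ConjClasses.mk (ρ c) = c.1) ∧ ∀ c d, (edgeGraph G).Adj c d → Commute (ρ c) (ρ d)

/-- No nontrivial product of distinct elements of `V` is trivial in `Gᵃᵇ`.  (If `Gᵃᵇ` is an
elementary abelian 2-group: the images of the elements of `V` are linearly independent over
`ℤ/2ℤ`.) -/
def NoProductRelation (V : Set (InvolutionClass G)) : Prop :=
  ∀ F : Finset (InvolutionClass G), (F : Set (InvolutionClass G)) ⊆ V → F.Nonempty →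
    ∏ c ∈ F, c.image ≠ 1

/-! ### The collapsing procedure -/

variable (G) in
/-- A state of the collapsing procedure: the set of those vertices whose star-equivalence class has
been considered, and the set `V` of the vertices chosen so far. -/
structure CollapseState where
  considered : Set (InvolutionClass G)
  chosen : Set (InvolutionClass G)

variable (G) in
/-- The initial state. -/
def CollapseState.init : CollapseState G := ⟨∅, ∅⟩

/-- One round of the collapsing procedure: a class `[w]` is taken which has not been considered, but
all classes above which have been; with `|S_w| = 2 ^ k - 1` and `k' = |S_w ∩ V|`, a set `B` of
`k - k'` vertices of `[w]` is added to `V`, without introducing a nontrivial product relation. -/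
def CollapseStep (s t : CollapseState G) : Prop :=
  ∃ w : InvolutionClass G,
    w ∉ s.considered ∧
    (∀ v, star (edgeGraph G) w ⊂ star (edgeGraph G) v → v ∈ s.considered) ∧
    ∃ k : ℕ, (cliqueAbove (edgeGraph G) w).ncard = 2 ^ k - 1 ∧
    ∃ B : Set (InvolutionClass G), B ⊆ starClass (edgeGraph G) w ∧ Disjoint B s.chosen ∧
      B.ncard + (cliqueAbove (edgeGraph G) w ∩ s.chosen).ncard = k ∧
      NoProductRelation (s.chosen ∪ B) ∧
      t = ⟨s.considered ∪ starClass (edgeGraph G) w, s.chosen ∪ B⟩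

/-- The states that the collapsing procedure can reach. -/
def CollapseState.Reachable (s : CollapseState G) : Prop :=
  Relation.ReflTransGen CollapseStep (CollapseState.init G) s

/-- `V` is a possible final vertex set of the collapsing procedure. -/
def CollapsesTo (V : Set (InvolutionClass G)) : Prop :=
  CollapseState.Reachable ⟨Set.univ, V⟩

/-- The collapsed graph `C(Γ')` on a final vertex set `V`: the induced subgraph of `Γ'`. -/
abbrev collapsedGraph (V : Set (InvolutionClass G)) : SimpleGraph V := (edgeGraph G).induce V

theorem IsFullSystem.mul_self {ρ : InvolutionClass G → G} (hρ : IsFullSystem ρ)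
    (c : InvolutionClass G) : ρ c * ρ c = 1 := by
  obtain ⟨x, hx, hc⟩ := c.2
  rw [← hρ.1 c, ConjClasses.mk_eq_mk_iff_isConj] at hc
  obtain ⟨g, hg⟩ := isConj_iff.mp hc
  have h2 : x * x = 1 := by rw [← pow_two, ← hx]; exact pow_orderOf_eq_one x
  rw [← hg]
  calc g * x * g⁻¹ * (g * x * g⁻¹) = g * (x * x) * g⁻¹ := by group
    _ = 1 := by rw [h2]; simp

theorem IsFullSystem.isLiftable {ρ : InvolutionClass G → G} (hρ : IsFullSystem ρ)
    (V : Set (InvolutionClass G)) :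
    (coxMatrix (collapsedGraph V)).IsLiftable (fun c : V => ρ c) := by
  intro i j
  simp only [coxMatrix, Matrix.of_apply]
  split_ifs with h1 h2
  · subst h1
    simpa using hρ.mul_self i
  · have hc : Commute (ρ i) (ρ j) := hρ.2 i j h2
    rw [hc.mul_pow, pow_two, pow_two, hρ.mul_self, hρ.mul_self, one_mul]
  · simp

/-- The candidate map `φ : W_Γ → G`, for `Γ = C(Γ')`, sending each generator to the label (that is,
the chosen representative) of the corresponding vertex. -/
def candidateMap {ρ : InvolutionClass G → G} (hρ : IsFullSystem ρ)
    (V : Set (InvolutionClass G)) : W (collapsedGraph V) →* G :=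
  (coxMatrix (collapsedGraph V)).toCoxeterSystem.lift ⟨fun c => ρ c, hρ.isLiftable V⟩

/-! ### The recognition procedure -/

variable (G) in
/-- What the procedure may return.  Together with **True** it hands over the vertex set `V` of
`C(Γ')` and the full system of representatives `ρ` that it has used as labels. -/
inductive Verdict : Type u
  | yes (V : Set (InvolutionClass G)) (ρ : InvolutionClass G → G)
  | no
  | unknown

variable (G) in
/-- `Returns G r`: some run of the procedure on `G` (it involves choices) returns `r`. -/
inductive Returns : Verdict G → Prop
  /-- There are infinitely many classes of involutions. -/
  | no_of_infinite (h1 : ¬ Finite (InvolutionClass G)) : Returns .no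
  /-- `Γ'` is not a clique graph. -/
  | no_of_not_cliqueGraph (h1 : Finite (InvolutionClass G))
      (h3 : ¬ IsCliqueGraph (edgeGraph G)) : Returns .no
  /-- There is no full system of representatives. -/
  | no_of_no_fullSystem (h1 : Finite (InvolutionClass G)) (h3 : IsCliqueGraph (edgeGraph G))
      (h4 : ¬ ∃ ρ : InvolutionClass G → G, IsFullSystem ρ) : Returns .no
  /-- The candidate map is an isomorphism. -/
  | yes_of_bijective (h1 : Finite (InvolutionClass G)) (h3 : IsCliqueGraph (edgeGraph G))
      (ρ : InvolutionClass G → G) (h4 : IsFullSystem ρ)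
      (V : Set (InvolutionClass G)) (h5 : CollapsesTo V)
      (h6 : Function.Bijective (candidateMap h4 V)) : Returns (.yes V ρ)
  /-- The candidate map is not an isomorphism. -/
  | unknown_of_not_bijective (h1 : Finite (InvolutionClass G)) (h3 : IsCliqueGraph (edgeGraph G))
      (ρ : InvolutionClass G → G) (h4 : IsFullSystem ρ)
      (V : Set (InvolutionClass G)) (h5 : CollapsesTo V)
      (h6 : ¬ Function.Bijective (candidateMap h4 V)) : Returns .unknown
  /-- The collapsing gets stuck: the required vertices cannot be chosen without introducing a
  nontrivial product relation. -/
  | unknown_of_stuck (h1 : Finite (InvolutionClass G)) (h3 : IsCliqueGraph (edgeGraph G))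
      (ρ : InvolutionClass G → G) (h4 : IsFullSystem ρ)
      (s : CollapseState G) (hs : s.Reachable) (hs' : s.considered ≠ Set.univ)
      (h5 : ∀ t, ¬ CollapseStep s t) : Returns .unknown

end Group

end

end RACG

/-! A **True** verdict already carries the presentation, since the candidate map is bijective; only
nonemptiness of the graph and its universe need care.

For **False**, one shows that every test passes for `W Γ`. Sending a clique to the product of its
generators is a bijection onto the classes of involutions (`cliqueClass_bijective`). It is injective
because the abelianization recovers the clique. In the abelianization, the product of two clique
images is the image of the symmetric difference, and for distinct cliques `C`, `D` this is a clique
exactly when `C ∪ D` is one. So the edge graph is the clique graph of `Γ`, and the clique products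
form a full system of representatives.

The substance is surjectivity (`exists_conj_eq_cliqueProd`): an involution can be shortened by
conjugation until it is a clique product. This rests on the word problem (`wordProd_ne_one`): a
nonempty word without cancellation is nontrivial, because in a reflection representation it keeps
certain vectors nonnegative. -/

namespace RACG

/-! ### Words in a right-angled Coxeter group -/

section Words

variable {V : Type*} (Γ : SimpleGraph V)

/-- The letter `t` occurs in the word and commutes with everything in front of an occurrence. -/
def CanMoveToFront (t : V) : List V → Prop
  | [] => False
  | a :: w => a = t ∨ (Γ.Adj a t ∧ CanMoveToFront t w)

/-- No two equal letters of the word can be brought next to each other by commutations. -/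
def NoCancellation : List V → Prop
  | [] => True
  | a :: w => ¬ CanMoveToFront Γ a w ∧ NoCancellation w

variable {Γ}

theorem CanMoveToFront.append {t : V} {x y : List V} (h : CanMoveToFront Γ t (x ++ y)) :
    CanMoveToFront Γ t x ∨ ((∀ a ∈ x, Γ.Adj a t) ∧ CanMoveToFront Γ t y) := by
  induction x with
  | nil => exact Or.inr ⟨by simp, h⟩
  | cons a x ih =>
    rcases h with h | ⟨h, h'⟩
    · exact Or.inl (Or.inl h)
    · rcases ih h' with h1 | ⟨h1, h2⟩
      · exact Or.inl (Or.inr ⟨h, h1⟩)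
      · exact Or.inr ⟨by simpa using ⟨h, h1⟩, h2⟩

/-- When both factors are reduced, a cancelling pair must straddle the seam: its left letter moves
to the end of `w`, its right letter to the front of `w'`. -/
theorem NoCancellation.exists_of_append {w w' : List V} (hw : NoCancellation Γ w)
    (hw' : NoCancellation Γ w') (h : ¬ NoCancellation Γ (w ++ w')) :
    ∃ x t y, w = x ++ t :: y ∧ (∀ a ∈ y, Γ.Adj a t) ∧ CanMoveToFront Γ t w' := by
  induction w with
  | nil => exact absurd hw' h
  | cons a w ih =>
    by_cases h1 : CanMoveToFront Γ a (w ++ w')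
    · rcases h1.append with h2 | ⟨h2, h3⟩
      · exact absurd h2 hw.1
      · exact ⟨[], a, w, rfl, h2, h3⟩
    · obtain ⟨x, t, y, rfl, h2⟩ := ih hw.2 fun h2 => h ⟨h1, h2⟩
      exact ⟨a :: x, t, y, rfl, h2⟩

variable (Γ) in
theorem isLiftable_of_commute {M : Type*} [Monoid M] {f : V → M} (h1 : ∀ t, f t * f t = 1)
    (h2 : ∀ s t, Γ.Adj s t → Commute (f s) (f t)) : (coxMatrix Γ).IsLiftable f := by
  intro i j
  simp only [coxMatrix, Matrix.of_apply]
  split_ifs with h h'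
  · subst h
    simpa using h1 i
  · rw [(h2 i j h').mul_pow, pow_two, pow_two, h1, h1, one_mul]
  · simp

variable {G : Type*} [Group G] (cs : CoxeterSystem (coxMatrix Γ) G)

theorem commute_simple_of_adj {s t : V} (h : Γ.Adj s t) :
    Commute (cs.simple s) (cs.simple t) := by
  have h2 := cs.simple_mul_simple_pow s t
  have hM : coxMatrix Γ s t = 2 := by
    rw [coxMatrix]
    change Matrix.of _ s t = 2
    rw [Matrix.of_apply, if_neg h.ne, if_pos h]
  rw [hM, pow_two, mul_eq_one_iff_eq_inv, mul_inv_rev, cs.inv_simple, cs.inv_simple] at h2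
  exact h2

theorem commute_simple_wordProd {t : V} {w : List V} (h : ∀ a ∈ w, Γ.Adj a t) :
    Commute (cs.simple t) (cs.wordProd w) := by
  induction w with
  | nil => simp
  | cons a w ih =>
    rw [cs.wordProd_cons]
    exact ((commute_simple_of_adj cs (h a (by simp))).symm).mul_right
      (ih fun b hb => h b (by simp [hb]))

theorem CanMoveToFront.exists_wordProd_eq {t : V} {w : List V} (h : CanMoveToFront Γ t w) :
    ∃ w', cs.wordProd w = cs.simple t * cs.wordProd w' ∧ w'.length + 1 = w.length ∧ w' ⊆ w := by
  induction w with
  | nil => exact h.elim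
  | cons a w ih =>
    rcases h with rfl | ⟨h, h'⟩
    · exact ⟨w, cs.wordProd_cons _ _, rfl, by simp⟩
    · obtain ⟨w', h1, h2, h3⟩ := ih h'
      refine ⟨a :: w', ?_, by simp [h2], List.cons_subset_cons a h3⟩
      rw [cs.wordProd_cons, h1, cs.wordProd_cons, ← mul_assoc, ← mul_assoc,
        (commute_simple_of_adj cs h).eq]

theorem exists_shorter_of_not_noCancellation {w : List V} (h : ¬ NoCancellation Γ w) :
    ∃ w', cs.wordProd w = cs.wordProd w' ∧ w'.length < w.length ∧ w' ⊆ w := by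
  induction w with
  | nil => exact absurd trivial h
  | cons a w ih =>
    by_cases h1 : CanMoveToFront Γ a w
    · obtain ⟨w', h2, h3, h4⟩ := h1.exists_wordProd_eq cs
      refine ⟨w', ?_, by simp; omega, fun x hx => List.mem_cons_of_mem _ (h4 hx)⟩
      rw [cs.wordProd_cons, h2, cs.simple_mul_simple_cancel_left]
    · obtain ⟨w', h2, h3, h4⟩ := ih fun h2 => h ⟨h1, h2⟩
      exact ⟨a :: w', by rw [cs.wordProd_cons, cs.wordProd_cons, h2], by simpa using h3,
        List.cons_subset_cons a h4⟩

end Words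

/-! ### A linear representation -/

noncomputable section Representation

variable {V : Type*} [Fintype V] (Γ : SimpleGraph V)

open Classical in
/-- The sum of the coordinates at the vertices that are different from `t` and not adjacent
to it. -/
def nonNeighborSum (v : V → ℤ) (t : V) : ℤ := ∑ u, if u ≠ t ∧ ¬ Γ.Adj u t then v u else 0

open Classical in
/-- The reflection in the `t`-th basis vector, for the form with entries `1` on the diagonal,
`0` at edges and `-1` elsewhere. -/
def reflection (t : V) : Function.End (V → ℤ) :=
  fun v => Function.update v t (2 * nonNeighborSum Γ v t - v t)

variable {Γ}

@[simp] theorem reflection_apply_self (t : V) (v : V → ℤ) :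
    reflection Γ t v t = 2 * nonNeighborSum Γ v t - v t := by
  simp [reflection]

theorem reflection_apply_of_ne {t u : V} (h : u ≠ t) (v : V → ℤ) :
    reflection Γ t v u = v u := by
  simp [reflection, h]

theorem nonNeighborSum_congr {v v' : V → ℤ} {t : V}
    (h : ∀ u, u ≠ t → ¬ Γ.Adj u t → v u = v' u) :
    nonNeighborSum Γ v t = nonNeighborSum Γ v' t :=
  Finset.sum_congr rfl fun u _ => by
    split_ifs with hu
    · exact h u hu.1 hu.2
    · rfl

theorem nonNeighborSum_nonneg {v : V → ℤ} (hv : ∀ u, 0 ≤ v u) (t : V) :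
    0 ≤ nonNeighborSum Γ v t :=
  Finset.sum_nonneg fun u _ => by
    split_ifs
    · exact hv u
    · rfl

open Classical in
theorem le_nonNeighborSum {v : V → ℤ} (hv : ∀ u, 0 ≤ v u) {s t : V} (hst : s ≠ t)
    (h : ¬ Γ.Adj s t) : v s ≤ nonNeighborSum Γ v t := by
  have h1 := Finset.single_le_sum (f := fun u => if u ≠ t ∧ ¬ Γ.Adj u t then v u else 0)
    (fun u _ => by
      split_ifs
      · exact hv u
      · rfl) (Finset.mem_univ s)
  simp only [hst, h, ne_eq, not_false_eq_true, and_self, if_true] at h1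
  refine h1.trans (le_of_eq (Finset.sum_congr rfl fun u _ => ?_))
  congr

theorem nonNeighborSum_reflection_self (t : V) (v : V → ℤ) :
    nonNeighborSum Γ (reflection Γ t v) t = nonNeighborSum Γ v t :=
  nonNeighborSum_congr fun _ hu _ => reflection_apply_of_ne hu v

theorem nonNeighborSum_reflection_of_adj {s t : V} (h : Γ.Adj s t) (v : V → ℤ) :
    nonNeighborSum Γ (reflection Γ s v) t = nonNeighborSum Γ v t :=
  nonNeighborSum_congr fun u _ hu =>
    reflection_apply_of_ne (fun hus => hu (by rw [hus]; exact h)) v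

theorem reflection_mul_self (t : V) : reflection Γ t * reflection Γ t = 1 := by
  funext v u
  change reflection Γ t (reflection Γ t v) u = v u
  by_cases h : u = t
  · subst h
    simp [nonNeighborSum_reflection_self]
  · rw [reflection_apply_of_ne h, reflection_apply_of_ne h]

/-- Neither of two adjacent vertices enters the sum defining the other's reflection. -/
theorem commute_reflection {s t : V} (h : Γ.Adj s t) :
    Commute (reflection Γ s) (reflection Γ t) := by
  funext v u
  change reflection Γ s (reflection Γ t v) u = reflection Γ t (reflection Γ s v) u
  by_cases hs : u = s
  · subst hs
    rw [reflection_apply_of_ne h.ne, reflection_apply_self, reflection_apply_self,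
      nonNeighborSum_reflection_of_adj h.symm, reflection_apply_of_ne h.ne]
  · by_cases ht : u = t
    · subst ht
      rw [reflection_apply_of_ne hs, reflection_apply_self, reflection_apply_self,
        nonNeighborSum_reflection_of_adj h, reflection_apply_of_ne hs]
    · simp only [reflection_apply_of_ne hs, reflection_apply_of_ne ht]

variable {G : Type*} [Group G] (cs : CoxeterSystem (coxMatrix Γ) G)

/-- The representation of `W_Γ` by reflections. -/
def reflectionRep : G →* Function.End (V → ℤ) :=
  cs.lift ⟨reflection Γ, isLiftable_of_commute Γ reflection_mul_self fun _ _ => commute_reflection⟩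

theorem reflectionRep_simple (t : V) : reflectionRep cs (cs.simple t) = reflection Γ t :=
  cs.lift_apply_simple _ t

-- Positivity of roots. The second clause strengthens the induction: it says that reflecting in a
-- letter which causes no cancellation cannot decrease its coordinate, so that coordinate stays
-- nonnegative.
open Classical in
theorem reflectionRep_wordProd_nonneg (s : V) (w : List V)
    (h : NoCancellation Γ (w ++ [s])) :
    (∀ t, 0 ≤ reflectionRep cs (cs.wordProd w) (Pi.single s 1) t) ∧
      ∀ t, ¬ CanMoveToFront Γ t (w ++ [s]) →
        reflectionRep cs (cs.wordProd w) (Pi.single s 1) t ≤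
          nonNeighborSum Γ (reflectionRep cs (cs.wordProd w) (Pi.single s 1)) t := by
  induction w with
  | nil =>
    have h0 : ∀ t, 0 ≤ (Pi.single s 1 : V → ℤ) t := fun t => by
      by_cases hts : t = s
      · subst hts; simp
      · simp [hts]
    have h1 : reflectionRep cs (cs.wordProd []) (Pi.single s 1) = (Pi.single s 1 : V → ℤ) := by
      rw [cs.wordProd_nil, map_one]; rfl
    rw [h1]
    refine ⟨h0, fun t ht => ?_⟩
    have hts : t ≠ s := fun hts => ht (Or.inl hts.symm)
    rw [Pi.single_eq_of_ne hts]
    exact nonNeighborSum_nonneg h0 t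
  | cons a w ih =>
    obtain ⟨h1, h2⟩ := ih h.2
    have ha := h2 a h.1
    have hv : reflectionRep cs (cs.wordProd (a :: w)) (Pi.single s 1) =
        reflection Γ a (reflectionRep cs (cs.wordProd w) (Pi.single s 1)) := by
      rw [cs.wordProd_cons, map_mul, reflectionRep_simple]; rfl
    rw [hv]
    generalize reflectionRep cs (cs.wordProd w) (Pi.single s 1) = v at h1 h2 ha
    have h3 : ∀ t, 0 ≤ reflection Γ a v t := fun t => by
      by_cases hta : t = a
      · subst hta
        rw [reflection_apply_self]
        linarith [h1 t]
      · rw [reflection_apply_of_ne hta]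
        exact h1 t
    refine ⟨h3, fun t ht => ?_⟩
    have hta : t ≠ a := fun hta => ht (Or.inl hta.symm)
    rw [reflection_apply_of_ne hta]
    by_cases hadj : Γ.Adj a t
    · rw [nonNeighborSum_reflection_of_adj hadj]
      exact h2 t fun h4 => ht (Or.inr ⟨hadj, h4⟩)
    -- With `N` the sum at `a` before reflecting, `v t ≤ N ≤ 2 * N - v a`, and the last term is the
    -- new coordinate at `a`, a summand of the new sum at `t`.
    · have h4 := le_nonNeighborSum h1 hta (fun h => hadj h.symm)
      have h5 := le_nonNeighborSum h3 hta.symm hadj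
      rw [reflection_apply_self] at h5
      linarith

theorem wordProd_ne_one {w : List V} (h : NoCancellation Γ w) (hw : w ≠ []) :
    cs.wordProd w ≠ 1 := by
  classical
  obtain ⟨w, s, rfl⟩ : ∃ w' s, w = w' ++ [s] := ⟨_, _, (List.dropLast_append_getLast hw).symm⟩
  intro h1
  have h2 := (reflectionRep_wordProd_nonneg cs s w h).1 s
  -- The prefix `w` would act as the reflection in `s`, which turns the coordinate `1` of the basis
  -- vector into `-1`.
  rw [cs.wordProd_append, cs.wordProd_singleton, mul_eq_one_iff_eq_inv, cs.inv_simple] at h1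
  rw [h1, reflectionRep_simple, reflection_apply_self] at h2
  have h3 : nonNeighborSum Γ (Pi.single s 1) s = nonNeighborSum Γ 0 s :=
    nonNeighborSum_congr fun u hu _ => by simp [hu]
  have h4 : nonNeighborSum Γ 0 s = 0 := by simp [nonNeighborSum]
  rw [h3, h4, Pi.single_eq_same] at h2
  omega

end Representation

/-! ### Involutions are conjugate to products over cliques -/

noncomputable section Involutions

variable {V : Type*} {Γ : SimpleGraph V}

theorem pairwise_commute_of_isClique {M : Type*} [Monoid M] {f : V → M}
    (hf : ∀ s t, Γ.Adj s t → Commute (f s) (f t)) {C : Finset V}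
    (hC : Γ.IsClique (C : Set V)) :
    (C : Set V).Pairwise (Function.onFun Commute f) :=
  fun s hs t ht h => hf s t (hC hs ht h)

variable {G : Type*} [Group G] (cs : CoxeterSystem (coxMatrix Γ) G)

/-- The product of the generators in a clique. -/
def cliqueProd (C : Finset V) (hC : Γ.IsClique (C : Set V)) : G :=
  C.noncommProd cs.simple
    (pairwise_commute_of_isClique (fun _ _ => commute_simple_of_adj cs) hC)

/-- Since `w * w` is trivial, a reduced nonempty `w` cancels against its own copy, which yields a
conjugation shortening it or a central letter to split off. That `C` and `u` use only letters of `w`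
is what lets a split-off letter commute with both in the induction. -/
theorem exists_conj_eq_cliqueProd [Fintype V] (w : List V)
    (hw : cs.wordProd w * cs.wordProd w = 1) :
    ∃ (C : Finset V) (hC : Γ.IsClique (C : Set V)), (∀ c ∈ C, c ∈ w) ∧ ∃ u, u ⊆ w ∧
      cs.wordProd u * cs.wordProd w * (cs.wordProd u)⁻¹ = cliqueProd cs C hC := by
  classical
  induction hn : w.length using Nat.strong_induction_on generalizing w with
  | _ n ih =>
  subst hn
  by_cases hred : NoCancellation Γ w
  swap
  · obtain ⟨w', h1, h2, h3⟩ := exists_shorter_of_not_noCancellation cs hred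
    obtain ⟨C, hC, h4, u, h5, h6⟩ := ih _ h2 w' (by rw [← h1, hw]) rfl
    exact ⟨C, hC, fun c hc => h3 (h4 c hc), u, fun x hx => h3 (h5 hx), by rw [h1, h6]⟩
  rcases eq_or_ne w [] with rfl | hne
  · exact ⟨∅, by simp, by simp, [], by simp, by simp [cliqueProd]⟩
  have hww : ¬ NoCancellation Γ (w ++ w) := fun h =>
    wordProd_ne_one cs h (by simp [hne]) (by rw [cs.wordProd_append, hw])
  obtain ⟨x, t, y, rfl, hy, ht⟩ := hred.exists_of_append hred hww
  have hprod : cs.wordProd (x ++ t :: y) =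
      cs.wordProd x * (cs.wordProd y * cs.simple t) := by
    rw [cs.wordProd_append, cs.wordProd_cons, (commute_simple_wordProd cs hy).eq]
  rcases ht.append with hx | ⟨hx, -⟩
  -- A second `t` in `x` moves to the front, so `w` is `t * (x' ++ y) * t` and conjugation by `t`
  -- removes two letters.
  · obtain ⟨x', h1, h2, h3⟩ := hx.exists_wordProd_eq cs
    have hconj : cs.wordProd (x ++ t :: y) =
        cs.simple t * cs.wordProd (x' ++ y) * cs.simple t := by
      rw [hprod, h1, cs.wordProd_append]; group
    have hsub : x' ++ y ⊆ x ++ t :: y := by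
      intro a ha
      rcases List.mem_append.1 ha with ha | ha
      · exact List.mem_append_left _ (h3 ha)
      · simp [ha]
    have hsq : cs.wordProd (x' ++ y) * cs.wordProd (x' ++ y) = 1 := by
      have h4 : cs.wordProd (x' ++ y) =
          cs.simple t * cs.wordProd (x ++ t :: y) * (cs.simple t)⁻¹ := by
        rw [hconj, cs.inv_simple, mul_assoc, cs.simple_mul_simple_cancel_right,
          cs.simple_mul_simple_cancel_left]
      rw [h4, conj_mul, hw]; simp
    obtain ⟨C, hC, h4, u, h5, h6⟩ := ih _ (by simp; omega) _ hsq rfl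
    refine ⟨C, hC, fun c hc => hsub (h4 c hc), u ++ [t], ?_, ?_⟩
    · intro a ha
      rcases List.mem_append.1 ha with ha | ha
      · exact hsub (h5 ha)
      · simp_all
    · rw [← h6, hconj, cs.wordProd_append, cs.wordProd_singleton, mul_inv_rev, cs.inv_simple]
      simp only [mul_assoc, cs.simple_mul_simple_cancel_left]
  -- Otherwise `t` is adjacent to all the other letters: it splits off and is added to the clique
  -- found for `x ++ y`.
  · have hxy : ∀ a ∈ x ++ y, Γ.Adj a t := fun a ha =>
      (List.mem_append.1 ha).elim (hx a) (hy a)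
    have hcomm := commute_simple_wordProd cs hxy
    have hdec : cs.wordProd (x ++ t :: y) = cs.simple t * cs.wordProd (x ++ y) := by
      rw [hcomm.eq, hprod, cs.wordProd_append, mul_assoc]
    have hsub : x ++ y ⊆ x ++ t :: y := by
      intro a ha
      simp only [List.mem_append, List.mem_cons] at ha ⊢
      tauto
    have hsq : cs.wordProd (x ++ y) * cs.wordProd (x ++ y) = 1 := by
      rw [hdec, mul_assoc, ← mul_assoc (cs.wordProd (x ++ y)), ← hcomm.eq, mul_assoc,
        cs.simple_mul_simple_cancel_left] at hw
      exact hw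
    obtain ⟨C, hC, h4, u, h5, h6⟩ := ih _ (by simp) _ hsq rfl
    have htC : t ∉ C := fun h => (hxy t (h4 t h)).ne rfl
    refine ⟨insert t C, ?_, ?_, u, fun a ha => hsub (h5 ha), ?_⟩
    · rw [Finset.coe_insert]
      exact hC.insert fun b hb _ => (hxy b (h4 b hb)).symm
    · intro c hc
      rcases Finset.mem_insert.1 hc with rfl | hc
      · simp
      · exact hsub (h4 c hc)
    · rw [cliqueProd, Finset.noncommProd_insert_of_notMem _ _ _ _ htC]
      change _ = cs.simple t * cliqueProd cs C hC
      have hu := commute_simple_wordProd cs (t := t) fun a ha => hxy a (h5 ha)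
      rw [← h6, hdec]
      simp only [← mul_assoc, hu.eq]

theorem cliqueProd_mul_self (C : Finset V) (hC : Γ.IsClique (C : Set V)) :
    cliqueProd cs C hC * cliqueProd cs C hC = 1 := by
  have hcomm := pairwise_commute_of_isClique (fun _ _ => commute_simple_of_adj cs) hC
  rw [cliqueProd, ← Finset.noncommProd_mul_distrib _ _ hcomm hcomm
    (fun s hs t ht h => hcomm hs ht h)]
  rw [Finset.noncommProd_eq_pow_card _ _ _ 1 (fun x _ => by simp), one_pow]

theorem commute_cliqueProd {C D : Finset V} (hC : Γ.IsClique (C : Set V))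
    (hD : Γ.IsClique (D : Set V)) (h : Γ.IsClique ((C : Set V) ∪ D)) :
    Commute (cliqueProd cs C hC) (cliqueProd cs D hD) := by
  refine Finset.noncommProd_commute _ _ _ _ fun d hd => (Commute.symm ?_)
  refine Finset.noncommProd_commute _ _ _ _ fun c hc => ?_
  rcases eq_or_ne d c with rfl | hne
  · exact Commute.refl _
  · exact commute_simple_of_adj cs (h (Or.inr hd) (Or.inl hc) hne)

theorem of_cliqueProd (C : Finset V) (hC : Γ.IsClique (C : Set V)) :
    Abelianization.of (cliqueProd cs C hC) = ∏ c ∈ C, Abelianization.of (cs.simple c) := by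
  rw [cliqueProd, Finset.map_noncommProd, Finset.noncommProd_eq_prod]

open Classical in
/-- The coordinates of an element of the abelianization of `W_Γ`. -/
def abCoord : Abelianization G →* Multiplicative (V → ZMod 2) :=
  Abelianization.lift <| cs.lift ⟨fun t => Multiplicative.ofAdd (Pi.single t 1),
    isLiftable_of_commute Γ
      (fun t => by
        rw [← ofAdd_add, ← Pi.single_add, show (1 : ZMod 2) + 1 = 0 from rfl]; simp)
      fun _ _ _ => Commute.all _ _⟩

open Classical in
theorem abCoord_prod (C : Finset V) :
    (abCoord cs (∏ c ∈ C, Abelianization.of (cs.simple c))).toAdd =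
      fun t => if t ∈ C then 1 else 0 := by
  funext t
  have h : ∀ c, abCoord cs (Abelianization.of (cs.simple c)) =
      Multiplicative.ofAdd (Pi.single c 1) := fun c => by
    rw [abCoord, Abelianization.lift_apply_of, cs.lift_apply_simple]
  simp [map_prod, h, toAdd_prod, Finset.sum_apply, Pi.single_apply]

/-- The coordinates of the product modulo 2 are the indicator function of the set. -/
theorem prod_of_simple_injective :
    Function.Injective fun C : Finset V => ∏ c ∈ C, Abelianization.of (cs.simple c) := by
  classical
  intro C D h
  have h1 := congrArg (fun a => (abCoord cs a).toAdd) h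
  simp only [abCoord_prod] at h1
  ext t
  have h2 := congrFun h1 t
  by_cases hC : t ∈ C <;> by_cases hD : t ∈ D <;> simp_all

open Classical in
theorem prod_symmDiff {A : Type*} [CommGroup A] {f : V → A} (hf : ∀ t, f t * f t = 1)
    (C D : Finset V) : ∏ c ∈ symmDiff C D, f c = (∏ c ∈ C, f c) * ∏ c ∈ D, f c := by
  have h1 := Finset.prod_inter_mul_prod_sdiff C D f
  have h2 := Finset.prod_inter_mul_prod_sdiff D C f
  have h3 : (∏ c ∈ C ∩ D, f c) * ∏ c ∈ C ∩ D, f c = 1 := by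
    rw [← Finset.prod_mul_distrib]; simp [hf]
  have h4 : ∏ c ∈ symmDiff C D, f c = (∏ c ∈ C \ D, f c) * ∏ c ∈ D \ C, f c :=
    Finset.prod_union disjoint_sdiff_sdiff
  rw [Finset.inter_comm] at h2
  rw [h4, ← h1, ← h2, mul_mul_mul_comm, h3, one_mul]

end Involutions

/-! ### Classes of involutions and cliques -/

noncomputable section Classes

variable {V : Type*} {Γ : SimpleGraph V} {G : Type*} [Group G]
  (cs : CoxeterSystem (coxMatrix Γ) G)

theorem cliqueProd_ne_one {C : Finset V} (hC : Γ.IsClique (C : Set V)) (hne : C.Nonempty) :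
    cliqueProd cs C hC ≠ 1 := by
  intro h
  have h1 := of_cliqueProd cs C hC
  rw [h, map_one] at h1
  exact hne.ne_empty (prod_of_simple_injective cs (by simpa using h1.symm))

/-- The class of involutions that belongs to a clique. -/
def cliqueClass (C : Clique Γ) : InvolutionClass G :=
  ⟨ConjClasses.mk (cliqueProd cs C.1 C.2.2), cliqueProd cs C.1 C.2.2,
    orderOf_eq_prime (by rw [pow_two, cliqueProd_mul_self]) (cliqueProd_ne_one cs C.2.2 C.2.1), rfl⟩

theorem image_cliqueClass (C : Clique Γ) :
    (cliqueClass cs C).image = ∏ c ∈ C.1, Abelianization.of (cs.simple c) := by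
  rw [← of_cliqueProd cs C.1 C.2.2]; rfl

theorem cliqueClass_bijective [Finite V] : Function.Bijective (cliqueClass cs) := by
  constructor
  · intro C D h
    refine Subtype.ext (prod_of_simple_injective cs ?_)
    simpa only [image_cliqueClass] using congrArg InvolutionClass.image h
  · rintro ⟨_, x, hx, rfl⟩
    have := Fintype.ofFinite V
    obtain ⟨w, rfl⟩ := cs.wordProd_surjective x
    obtain ⟨C, hC, -, u, -, hu⟩ := exists_conj_eq_cliqueProd cs w
      (by rw [← pow_two, ← hx, pow_orderOf_eq_one])
    have hne : C.Nonempty := by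
      rw [Finset.nonempty_iff_ne_empty]
      rintro rfl
      have h1 : cs.wordProd w = 1 := by
        simpa [cliqueProd] using hu
      simp [h1] at hx
    refine ⟨⟨C, hne, hC⟩, Subtype.ext ?_⟩
    exact (ConjClasses.mk_eq_mk_iff_isConj.2 (isConj_iff.2 ⟨_, hu⟩)).symm

theorem edgeGraph_adj_cliqueClass_iff [Finite V] (C D : Clique Γ) :
    (edgeGraph G).Adj (cliqueClass cs C) (cliqueClass cs D) ↔ (cliqueGraph Γ).Adj C D := by
  classical
  have hinj := (cliqueClass_bijective cs).1
  have hsymm := prod_symmDiff (f := fun t => Abelianization.of (cs.simple t))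
    (fun t => by rw [← map_mul, cs.simple_mul_simple_self, map_one]) C.1 D.1
  constructor
  · rintro ⟨hne, z, -, -, hz⟩
    obtain ⟨E, rfl⟩ := (cliqueClass_bijective cs).2 z
    simp only [image_cliqueClass, ← hsymm] at hz
    have hE : E.1 = symmDiff C.1 D.1 := prod_of_simple_injective cs hz
    refine ⟨fun h => hne (h ▸ rfl), fun a ha b hb hab => ?_⟩
    -- Two vertices of the union lie together in `C` or in `D`, or else one is in each difference
    -- and both lie in the clique `E`.
    by_cases haC : a ∈ C.1 <;> by_cases haD : a ∈ D.1 <;> by_cases hbC : b ∈ C.1 <;>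
      by_cases hbD : b ∈ D.1 <;>
      first
      | exact C.2.2 haC hbC hab
      | exact D.2.2 haD hbD hab
      | exact E.2.2 (Finset.mem_coe.2 (by rw [hE, Finset.mem_symmDiff]; tauto))
          (Finset.mem_coe.2 (by rw [hE, Finset.mem_symmDiff]; tauto)) hab
      | simp_all
  · rintro ⟨hne, hcl⟩
    have hne' : C.1 ≠ D.1 := fun h => hne (Subtype.ext h)
    let E : Clique Γ := ⟨symmDiff C.1 D.1,
      Finset.nonempty_iff_ne_empty.2 fun h => hne' (symmDiff_eq_bot.1 h),
      hcl.subset (by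
        intro a ha
        rcases Finset.mem_symmDiff.1 (Finset.mem_coe.1 ha) with h | h
        · exact Or.inl h.1
        · exact Or.inr h.1)⟩
    -- `E` differs from `C` because `D` is nonempty, and from `D` because `C` is.
    refine ⟨hinj.ne hne, cliqueClass cs E, hinj.ne fun h => ?_, hinj.ne fun h => ?_, ?_⟩
    · exact D.2.1.ne_empty (symmDiff_eq_left.1 (congrArg Subtype.val h))
    · exact C.2.1.ne_empty (symmDiff_eq_right.1 (congrArg Subtype.val h))
    · simp only [image_cliqueClass]
      exact hsymm

/-- The graph of classes of involutions of `W_Γ` is the clique graph of `Γ`. -/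
def cliqueGraphIso [Finite V] : cliqueGraph Γ ≃g edgeGraph G where
  toEquiv := Equiv.ofBijective _ (cliqueClass_bijective cs)
  map_rel_iff' := edgeGraph_adj_cliqueClass_iff cs _ _

theorem exists_isFullSystem {V : Type*} [Finite V] {Γ : SimpleGraph V} {G : Type*} [Group G]
    (cs : CoxeterSystem (coxMatrix Γ) G) : ∃ ρ : InvolutionClass G → G, IsFullSystem ρ := by
  let e := cliqueGraphIso cs
  refine ⟨fun c => cliqueProd cs (e.symm c).1 (e.symm c).2.2, fun c => ?_, fun c d h => ?_⟩
  · exact congrArg Subtype.val (e.apply_symm_apply c)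
  · exact commute_cliqueProd cs _ _ (e.symm.map_adj_iff.2 h).2

end Classes

/-! ### Correctness of the two verdicts -/

theorem finite_clique {V : Type*} [Finite V] (Γ : SimpleGraph V) : Finite (Clique Γ) :=
  Subtype.finite

theorem IsCliqueGraph.nonempty {V : Type*} {Γ' : SimpleGraph V} (h : IsCliqueGraph Γ') :
    Nonempty V := by
  obtain ⟨U, -, ⟨u⟩, Γ, ⟨e⟩⟩ := h
  exact ⟨e.symm ⟨{u}, by simp, by simp⟩⟩

theorem not_isRACG_of_returns_no {G : Type*} [Group G] (h : Returns G .no) : ¬ IsRACG G := by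
  rintro ⟨V, _, _, Γ, ⟨f⟩⟩
  let cs : CoxeterSystem (coxMatrix Γ) G := ⟨f.symm⟩
  have := finite_clique Γ
  cases h with
  | no_of_infinite h1 => exact h1 (Finite.of_equiv _ (cliqueGraphIso cs).toEquiv)
  | no_of_not_cliqueGraph h1 h3 => exact h3 ⟨V, ‹_›, ‹_›, Γ, ⟨(cliqueGraphIso cs).symm⟩⟩
  | no_of_no_fullSystem h1 h3 h4 => exact h4 (exists_isFullSystem cs)

/-- Isomorphic graphs have isomorphic right-angled Coxeter groups. -/
theorem nonempty_W_mulEquiv {V V' : Type*} {Γ : SimpleGraph V} {Γ' : SimpleGraph V'}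
    (e : Γ ≃g Γ') : Nonempty (W Γ' ≃* W Γ) := by
  classical
  have h : (coxMatrix Γ).reindex e.toEquiv = coxMatrix Γ' := by
    refine CoxeterMatrix.ext ?_
    ext i j
    have hadj : Γ.Adj (e.symm i) (e.symm j) ↔ Γ'.Adj i j := e.symm.map_adj_iff
    have heq : e.symm i = e.symm j ↔ i = j := e.symm.injective.eq_iff
    simp only [coxMatrix, CoxeterMatrix.reindex, Matrix.reindex_apply, Matrix.submatrix_apply,
      Matrix.of_apply]
    exact if_congr heq rfl (if_congr hadj rfl rfl)
  change Nonempty ((coxMatrix Γ').Group ≃* (coxMatrix Γ).Group)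
  rw [← h]
  exact ⟨(coxMatrix Γ).reindexGroupEquiv e.toEquiv⟩

theorem Returns.isRACG_and_presentation {G : Type*} [Group G] {V : Set (InvolutionClass G)}
    {ρ : InvolutionClass G → G} (h : Returns G (.yes V ρ)) :
    IsRACG G ∧ ∃ cs : CoxeterSystem (coxMatrix (collapsedGraph V)) G,
      ∀ v : V, cs.simple v = ρ v := by
  cases h with
  | yes_of_bijective h1 h3 _ h4 _ h5 h6 =>
  let f : W (collapsedGraph V) ≃* G := MulEquiv.ofBijective _ h6
  let cs : CoxeterSystem (coxMatrix (collapsedGraph V)) G := ⟨f.symm⟩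
  refine ⟨?_, cs, fun v => ?_⟩
  -- A clique graph has a vertex, so `G` contains an involution, whereas with no generators `G`
  -- would be trivial.
  · have hV : Nonempty V := by
      by_contra hV
      rw [not_nonempty_iff] at hV
      obtain ⟨_, x, hx, -⟩ := h3.nonempty
      obtain ⟨w, rfl⟩ := cs.wordProd_surjective x
      obtain rfl : w = [] := List.eq_nil_iff_forall_not_mem.2 fun a => hV.elim a
      simp at hx
    -- `IsRACG` asks for vertices in `Type`, while `V` lives in the universe of `G`; hence the
    -- relabelling by `Fin m`.
    obtain ⟨m, ⟨e⟩⟩ := Finite.exists_equiv_fin V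
    obtain ⟨e'⟩ := nonempty_W_mulEquiv (SimpleGraph.Iso.map e (collapsedGraph V))
    exact ⟨Fin m, inferInstance, ⟨e hV.some⟩, _, ⟨e'.trans f⟩⟩
  · exact CoxeterSystem.lift_apply_simple _ (h4.isLiftable V) v

end RACG

theorem mainTheorem10 {G : Type*} [Group G]
    (htors : ∀ g : G, IsOfFinOrder g → g ≠ 1 → orderOf g = 2)
    (n : ℕ) (hab : Nonempty (Abelianization G ≃* Multiplicative (Fin n → ZMod 2))) :
    (∀ (V : Set (RACG.InvolutionClass G)) (ρ : RACG.InvolutionClass G → G),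
      RACG.Returns G (.yes V ρ) →
        RACG.IsRACG G ∧
        ∃ cs : CoxeterSystem (RACG.coxMatrix (RACG.collapsedGraph V)) G,
          ∀ v : V, cs.simple v = ρ v) ∧
    (RACG.Returns G .no → ¬ RACG.IsRACG G) := by
  exact ⟨fun _ _ h => h.isRACG_and_presentation, RACG.not_isRACG_of_returns_no⟩
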